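/- Let $d\ge 1$ and let $\mathbb U_1,\dots,\mathbb U_{d+1}$ be linear subspaces of $\mathbb R^n$ with $m_j=\dim\mathbb U_j$ and $\sum_{j=1}^{d+1}m_j=n$. Let $\mathrm{Flag}$ be the flag manifold of all tuples $\mathbb W=(\mathbb W_1,\dots,\mathbb W_{d+1})$ of pairwise orthogonal linear subspaces of $\mathbb R^n$ with $\dim\mathbb W_j=m_j$. For a subspace $\mathbb V\subseteq\mathbb R^n$ let $\tau(\mathbb V)\in O(n)$ be the matrix of the orthogonal reflection through $\mathbb V$ ($+1$ on $\mathbb V$, $-1$ on $\mathbb V^\perp$); $\mathrm{Flag}$ is regarded as an embedded submanifold of $(\mathbb R^{n\times n})^{d+1}$ through $\mathbb W\mapsto(\tau(\mathbb W_1),\dots,\tau(\mathbb W_{d+1}))$. Put $$F(\mathbb W)=\sum_{j=1}^{d+1}\|\tau(\mathbb U_j)-\tau(\mathbb W_j)\|_F^2,\qquad \mathbb W\in\mathrm{Flag}.$$ Consider the randomized coordinate minimization method for $F$: start from a (possibly random) point $\mathbb W^{(0)}\in\mathrm{Flag}$. At step $i=0,1,2,\dots$ choose a pair $(s_i,t_i)$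 uniformly at random from $\{(s,t):1\le s<t\le d+1\}$, independently of everything that happened before, and let $\mathbb W^{(i+1)}$ be a minimizer of $F(\mathbb X)$ over all $\mathbb X\in\mathrm{Flag}$ with $\mathbb X_j=\mathbb W^{(i)}_j$ for all $j\ne s_i,t_i$ (if there are several minimizers, any measurable choice, possibly randomized, that does not anticipate the later pairs is allowed). Then the sequence $(\mathbb W^{(i)})_{i\ge0}$ always has a cluster point in $\mathrm{Flag}$, and with probability $1$ every cluster point of $(\mathbb W^{(i)})_{i\ge0}$ is a stationary point of $F$ on $\mathrm{Flag}$, i.e. a point at which the differential (equivalently, the Riemannian gradient) of $F$ vanishes. -/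

import Mathlib

open MeasureTheory ProbabilityTheory Filter Topology

noncomputable section

namespace NearestFlag

/-- The matrix of the orthogonal reflection through the subspace `W` of `ℝⁿ`
(`+1` on `W`, `-1` on the orthogonal complement of `W`). This is the embedding of the
Grassmannian into the symmetric orthogonal matrices; see `tau_eq_of_frame`. -/
def tau {n : ℕ} (W : Submodule ℝ (EuclideanSpace ℝ (Fin n))) : Matrix (Fin n) (Fin n) ℝ :=
  Matrix.of fun a b => (W.reflection (EuclideanSpace.single b (1 : ℝ))) a

lemma tau_mulVec {n : ℕ} (W : Submodule ℝ (EuclideanSpace ℝ (Fin n)))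
    (x : EuclideanSpace ℝ (Fin n)) (a : Fin n) :
    ∑ b, tau W a b * x b = (W.reflection x) a := by
  have hx : x = ∑ b, x b • EuclideanSpace.single b (1 : ℝ) := by
    ext c
    simp [Pi.single_apply]
  conv_rhs => rw [hx]
  simp [tau, mul_comm]

/-- If the columns of the orthogonal matrix `V` with index in `S` span `W`, then
`tau W = V D Vᵀ`, where `D` is diagonal with entry `1` at the indices in `S` and `-1` elsewhere. -/
theorem tau_eq_of_frame {n : ℕ} (W : Submodule ℝ (EuclideanSpace ℝ (Fin n)))
    (V : Matrix (Fin n) (Fin n) ℝ) (hV : V ∈ Matrix.orthogonalGroup (Fin n) ℝ)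
    (S : Finset (Fin n))
    (hW : W = Submodule.span ℝ ((fun k => WithLp.toLp 2 (fun a => V a k)) '' (S : Set (Fin n)))) :
    tau W = V * Matrix.diagonal (fun k => if k ∈ S then (1 : ℝ) else -1) * V.transpose := by
  have h1 : V * V.transpose = 1 := (Matrix.mem_orthogonalGroup_iff (Fin n) ℝ).1 hV
  have h2 : V.transpose * V = 1 := (Matrix.mem_orthogonalGroup_iff' (Fin n) ℝ).1 hV
  have key : tau W * V = V * Matrix.diagonal (fun k => if k ∈ S then (1 : ℝ) else -1) := by
    ext a k
    rw [Matrix.mul_diagonal, Matrix.mul_apply]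
    have := tau_mulVec W (WithLp.toLp 2 (fun a => V a k)) a
    simp only at this
    rw [this]
    by_cases hk : k ∈ S
    · rw [Submodule.reflection_mem_subspace_eq_self]
      · simp [hk]
      · rw [hW]
        exact Submodule.subset_span ⟨k, hk, rfl⟩
    · rw [Submodule.reflection_mem_subspace_orthogonalComplement_eq_neg]
      · simp [hk]
      · rw [hW, Submodule.mem_orthogonal]
        intro u hu
        induction hu using Submodule.span_induction with
        | mem x hx =>
          obtain ⟨l, hl, rfl⟩ := hx
          have hlk : l ≠ k := fun h => hk (h ▸ hl)
          have := congrFun (congrFun h2 l) k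
          rw [Matrix.mul_apply, Matrix.one_apply_ne hlk] at this
          simpa [PiLp.inner_apply, mul_comm] using this
        | zero => simp
        | add x y _ _ hx hy => rw [inner_add_left, hx, hy, add_zero]
        | smul c x _ hx => rw [inner_smul_left, hx, mul_zero]
  rw [← key, Matrix.mul_assoc, h1, Matrix.mul_one]

/-- The squared Frobenius norm of a matrix. -/
def frobSq {n : ℕ} (A : Matrix (Fin n) (Fin n) ℝ) : ℝ := ∑ a, ∑ b, A a b ^ 2

/-- The flag manifold, a flag being given by its successive orthogonal differences: tuples of
`d + 1` pairwise orthogonal subspaces of `ℝⁿ` of dimensions `m 0, …, m d`. -/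
@[ext]
structure FlagMfd (d n : ℕ) (m : Fin (d + 1) → ℕ) where
  space : Fin (d + 1) → Submodule ℝ (EuclideanSpace ℝ (Fin n))
  finrank_eq : ∀ j, Module.finrank ℝ (space j) = m j
  ortho : ∀ j l, j ≠ l → space j ⟂ space l

variable {d n : ℕ} {m : Fin (d + 1) → ℕ}

/-- The embedding of the flag manifold into tuples of matrices. -/
def FlagMfd.emb (W : FlagMfd d n m) : Fin (d + 1) → Matrix (Fin n) (Fin n) ℝ :=
  fun j => tau (W.space j)

/-- The topology of the flag manifold as an embedded submanifold of the tuples of matrices. -/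
instance : TopologicalSpace (FlagMfd d n m) :=
  TopologicalSpace.induced FlagMfd.emb inferInstance

instance : MeasurableSpace (FlagMfd d n m) := borel _

instance : BorelSpace (FlagMfd d n m) := ⟨rfl⟩

/-- The function to be minimized, `F(W) = ∑ⱼ ‖τ(Uⱼ) - τ(Wⱼ)‖²` in the Frobenius norm. -/
def objective (U : Fin (d + 1) → Submodule ℝ (EuclideanSpace ℝ (Fin n)))
    (W : FlagMfd d n m) : ℝ :=
  ∑ j, frobSq (tau (U j) - tau (W.space j))

/-- `W` is a stationary point of `f`: the differential of `f` at `W` vanishes on the tangent space,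
that is, `f` has derivative zero along each curve in the flag manifold through `W` that is
differentiable there as a curve of tuples of matrices. -/
def IsStationary (f : FlagMfd d n m → ℝ) (W : FlagMfd d n m) : Prop :=
  ∀ c : ℝ → FlagMfd d n m, c 0 = W →
    (∀ j a b, DifferentiableAt ℝ (fun t => (c t).emb j a b) 0) →
    HasDerivAt (fun t => f (c t)) 0 0

/-- The pairs of indices `s < t`. -/
abbrev IndexPair (d : ℕ) : Type := {q : Fin (d + 1) × Fin (d + 1) // q.1 < q.2}

/-- The flags that are feasible in the sub-problem for the pair `q = (s, t)` at `W`: the subspaces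
with index other than `s` and `t` are those of `W`. -/
def Feasible (q : IndexPair d) (W X : FlagMfd d n m) : Prop :=
  ∀ j, j ≠ q.1.1 → j ≠ q.1.2 → X.space j = W.space j

/-- `X` solves the sub-problem for the pair `q = (s, t)` at `W`. -/
def SolvesSubproblem (f : FlagMfd d n m → ℝ) (q : IndexPair d) (W X : FlagMfd d n m) : Prop :=
  Feasible q W X ∧ ∀ Y, Feasible q W Y → f X ≤ f Y

/-- `W 0, W 1, …` are iterates of the coordinate minimization method for `f` in which the pair
`p i` used in step `i` is chosen uniformly at random, independently of all that happened before.
`ℱ i` is the information available before step `i`; the initial point, and the choice among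
several solutions of a sub-problem, may be arbitrary and random. -/
structure IsRandomizedCoordMin {Ω : Type*} [mΩ : MeasurableSpace Ω] (μ : Measure Ω)
    (ℱ : Filtration ℕ mΩ) (f : FlagMfd d n m → ℝ)
    (p : ℕ → Ω → IndexPair d) (W : ℕ → Ω → FlagMfd d n m) : Prop where
  measurable_iterate : ∀ i, Measurable[ℱ i] (W i)
  measurable_pair : ∀ i, Measurable[ℱ (i + 1)] (p i)
  uniform : ∀ i q, μ {ω | p i ω = q} = ((Fintype.card (IndexPair d) : ENNReal))⁻¹
  indep : ∀ i, Indep (MeasurableSpace.comap (p i) inferInstance) (ℱ i) μ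
  step : ∀ i, ∀ᵐ ω ∂μ, SolvesSubproblem f (p i ω) (W i ω) (W (i + 1) ω)

end NearestFlag

end

/-!
Write `Pⱼ` and `Qⱼ` for the orthogonal projections onto `Wⱼ` and `Uⱼ`. Up to a constant the objective
function is `-8 ∑ⱼ tr (Qⱼ Pⱼ)` (`objective_eq`), and the flags are exactly the tuples of symmetric
idempotent matrices `Pⱼ` with `tr Pⱼ = mⱼ` and `Pⱼ Pₗ = 0` for `j ≠ l`. These equations define
a compact set (`isCompact_projTuples`), so cluster points exist.

*Stationarity.* As the dimensions add up to `n`, one has `∑ⱼ Pⱼ = 1`. Hence each tangent vector `P'`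
has the form `P'ⱼ = [B, Pⱼ]`, and `∑ⱼ tr (Qⱼ P'ⱼ) = tr (B S)` with `S = ∑ⱼ [Pⱼ, Qⱼ]`. The blocks of
`S` are `Pₛ S Pₜ = Pₛ (Qₛ - Qₜ) Pₜ`, so a flag at which they vanish for all `s < t` is
stationary (`isStationary_of_gradBlock_eq_zero`).

*Decrease.* If the block `M` of the pair `(s, t)` is not zero, then conjugation by `exp (x (Mᵀ - M))`
changes only the subspaces with indices `s` and `t`, and `∑ⱼ tr (Qⱼ Pⱼ)` grows at
the initial rate `2 ‖M‖²`. Since the generator `Mᵀ - M` depends continuously on the flag, the same `x`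
gives a decrease of the objective function that is bounded below on a whole
neighbourhood (`exists_open_uniform_decrease`).

*Probability.* The objective function is bounded and never increases along the iterates, so the sum
over `i` of the probabilities that the iterate `i` lies in such a neighbourhood `N` and
the pair chosen in step `i` is `(s, t)` is finite. By independence these are the probabilities that
the iterate `i` lies in `N`, times a fixed positive factor. By the Borel–Cantelli lemma, almost
surely `N` is visited only finitely often (`IsRandomizedCoordMin.ae_eventually_notMem`). Countably
many such neighbourhoods, taken from a countable basis, cover all flags at which some block is
not zero.
-/

noncomputable section

namespace NearestFlag

variable {d n : ℕ} {m : Fin (d + 1) → ℕ}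

/-! ### Projection matrices of subspaces -/

/-- The matrix of the orthogonal projection of `ℝⁿ` onto `W`. -/
def projMatrix (W : Submodule ℝ (EuclideanSpace ℝ (Fin n))) : Matrix (Fin n) (Fin n) ℝ :=
  (Matrix.toEuclideanCLM (𝕜 := ℝ) (n := Fin n)).symm W.starProjection

lemma tau_eq_projMatrix (W : Submodule ℝ (EuclideanSpace ℝ (Fin n))) :
    tau W = (2 : ℝ) • projMatrix W - 1 := by
  have h (b : Fin n) : W.starProjection (EuclideanSpace.single b 1) =
      (projMatrix W).mulVec (Pi.single b 1) := by
    rw [← PiLp.ofLp_single 2, ← Matrix.ofLp_toEuclideanCLM, projMatrix]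
    simp
  ext a b
  simp [tau, Submodule.reflection_apply, h, two_smul, Matrix.one_apply]

lemma isStarProjection_projMatrix (W : Submodule ℝ (EuclideanSpace ℝ (Fin n))) :
    IsStarProjection (projMatrix W) := by
  have h := isStarProjection_starProjection (U := W)
  constructor
  · rw [IsIdempotentElem, projMatrix, ← map_mul, h.isIdempotentElem.eq]
  · have h2 := (Matrix.toEuclideanCLM (𝕜 := ℝ) (n := Fin n)).symm.map_star' W.starProjection
    rw [h.isSelfAdjoint.star_eq] at h2
    exact h2.symm

lemma projMatrix_transpose (W : Submodule ℝ (EuclideanSpace ℝ (Fin n))) :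
    (projMatrix W).transpose = projMatrix W := by
  rw [← Matrix.conjTranspose_eq_transpose_of_trivial]
  exact (isStarProjection_projMatrix W).isSelfAdjoint

lemma projMatrix_mul_self (W : Submodule ℝ (EuclideanSpace ℝ (Fin n))) :
    projMatrix W * projMatrix W = projMatrix W :=
  (isStarProjection_projMatrix W).isIdempotentElem

lemma projMatrix_injective :
    Function.Injective (projMatrix : Submodule ℝ (EuclideanSpace ℝ (Fin n)) → _) := by
  intro V W h
  exact Submodule.starProjection_inj.1
    (EquivLike.injective (Matrix.toEuclideanCLM (𝕜 := ℝ) (n := Fin n)).symm h)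

lemma projMatrix_mul_eq_zero_iff (V W : Submodule ℝ (EuclideanSpace ℝ (Fin n))) :
    projMatrix V * projMatrix W = 0 ↔ V ⟂ W := by
  rw [← Submodule.starProjection_comp_starProjection_eq_zero_iff, projMatrix, projMatrix,
    ← map_mul, map_eq_zero_iff _ (EquivLike.injective _)]
  rfl

lemma trace_projMatrix (W : Submodule ℝ (EuclideanSpace ℝ (Fin n))) :
    (projMatrix W).trace = Module.finrank ℝ W := by
  have h : LinearMap.IsProj W (W.starProjection : EuclideanSpace ℝ (Fin n) →ₗ[ℝ] _) :=
    ⟨fun x => Submodule.starProjection_apply_mem W x,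
      fun x hx => Submodule.starProjection_eq_self_iff.2 hx⟩
  rw [← h.trace, ← Matrix.trace_toLin_eq _ (EuclideanSpace.basisFun (Fin n) ℝ).toBasis,
    ← Matrix.toEuclideanLin_eq_toLin_orthonormal, ← Matrix.coe_toEuclideanCLM_eq_toEuclideanLin,
    projMatrix]
  simp

lemma exists_projMatrix_eq {P : Matrix (Fin n) (Fin n) ℝ} (hs : P.transpose = P)
    (hi : P * P = P) : ∃ W, projMatrix W = P := by
  have hP : IsStarProjection P :=
    ⟨hi, by rwa [← Matrix.conjTranspose_eq_transpose_of_trivial] at hs⟩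
  obtain ⟨W, _, hW⟩ := isStarProjection_iff_eq_starProjection.1
    (hP.map (Matrix.toEuclideanCLM (𝕜 := ℝ) (n := Fin n)))
  exact ⟨W, by simp [projMatrix, ← hW]⟩

/-! ### Flags as tuples of projection matrices -/

/-- The tuples of projection matrices of flags, described by polynomial equations. That each such
tuple comes from a flag is `exists_flag_proj_eq`. -/
def projTuples (d n : ℕ) (m : Fin (d + 1) → ℕ) :
    Set (Fin (d + 1) → Matrix (Fin n) (Fin n) ℝ) :=
  {P | (∀ j, (P j).transpose = P j) ∧ (∀ j, P j * P j = P j) ∧ (∀ j, (P j).trace = m j) ∧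
    ∀ j l, j ≠ l → P j * P l = 0}

/-- The tuple of projection matrices of a flag. -/
def FlagMfd.proj (W : FlagMfd d n m) (j : Fin (d + 1)) : Matrix (Fin n) (Fin n) ℝ :=
  projMatrix (W.space j)

lemma FlagMfd.proj_mem (W : FlagMfd d n m) : W.proj ∈ projTuples d n m :=
  ⟨fun _ => projMatrix_transpose _, fun _ => projMatrix_mul_self _,
    fun j => by rw [FlagMfd.proj, trace_projMatrix, W.finrank_eq],
    fun j l h => (projMatrix_mul_eq_zero_iff _ _).2 (W.ortho j l h)⟩

lemma FlagMfd.emb_eq (W : FlagMfd d n m) : W.emb = fun j => (2 : ℝ) • W.proj j - 1 :=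
  funext fun _ => tau_eq_projMatrix _

lemma FlagMfd.proj_eq (W : FlagMfd d n m) : W.proj = fun j => (1 / 2 : ℝ) • (W.emb j + 1) := by
  simp [FlagMfd.emb_eq, smul_smul]

lemma exists_flag_proj_eq {P : Fin (d + 1) → Matrix (Fin n) (Fin n) ℝ}
    (hP : P ∈ projTuples d n m) : ∃ W : FlagMfd d n m, W.proj = P := by
  obtain ⟨hs, hi, ht, ho⟩ := hP
  choose V hV using fun j => exists_projMatrix_eq (hs j) (hi j)
  refine ⟨⟨V, fun j => ?_, fun j l h => ?_⟩, funext hV⟩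
  · have := ht j
    rw [← hV, trace_projMatrix] at this
    exact_mod_cast this
  · rw [← projMatrix_mul_eq_zero_iff, hV, hV, ho j l h]

lemma range_proj : Set.range (FlagMfd.proj : FlagMfd d n m → _) = projTuples d n m :=
  Set.Subset.antisymm (Set.range_subset_iff.2 FlagMfd.proj_mem) fun _ h => exists_flag_proj_eq h

/-- The projections of a flag whose dimensions add up to `n` sum to the identity: the difference
is a projection of trace zero. -/
lemma FlagMfd.sum_proj (hm : ∑ j, m j = n) (W : FlagMfd d n m) : ∑ j, W.proj j = 1 := by
  obtain ⟨hs, hi, ht, ho⟩ := W.proj_mem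
  have hE : (∑ j, W.proj j) * (∑ j, W.proj j) = ∑ j, W.proj j := by
    rw [Finset.sum_mul]
    refine Finset.sum_congr rfl fun j _ => ?_
    rw [Finset.mul_sum, Finset.sum_eq_single j (fun l _ h => ho j l h.symm) (by simp), hi]
  set E := ∑ j, W.proj j with hEdef
  have hEs : E.transpose = E := by
    rw [hEdef, Matrix.transpose_sum]
    exact Finset.sum_congr rfl fun j _ => hs j
  have hEt : E.trace = n := by
    rw [hEdef, Matrix.trace_sum, Finset.sum_congr rfl fun j _ => ht j, ← hm]
    simp
  have h0 : ((1 - E).conjTranspose * (1 - E)).trace = 0 := by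
    rw [Matrix.conjTranspose_eq_transpose_of_trivial, Matrix.transpose_sub, Matrix.transpose_one,
      hEs, mul_sub, sub_mul, sub_mul, hE]
    simp [hEt]
  rw [Matrix.trace_conjTranspose_mul_self_eq_zero_iff] at h0
  exact (sub_eq_zero.1 h0).symm

lemma isInducing_emb : IsInducing (FlagMfd.emb : FlagMfd d n m → _) := ⟨rfl⟩

lemma continuous_proj : Continuous (FlagMfd.proj : FlagMfd d n m → _) := by
  have h := (isInducing_emb (d := d) (n := n) (m := m)).continuous
  rw [funext FlagMfd.proj_eq]
  fun_prop

lemma isCompact_projTuples : IsCompact (projTuples d n m) := by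
  have hcl : IsClosed (projTuples d n m) := by
    simp only [projTuples, Set.ofPred_and, Set.ofPred_forall]
    refine IsClosed.inter (isClosed_iInter fun j => ?_) (IsClosed.inter (isClosed_iInter fun j => ?_)
      (IsClosed.inter (isClosed_iInter fun j => ?_) (isClosed_iInter fun j => isClosed_iInter fun l =>
        isClosed_iInter fun _ => ?_)))
    all_goals refine isClosed_eq ?_ ?_ <;> fun_prop
  have hK : IsCompact (Set.univ.pi fun _ => Set.univ.pi fun _ => Set.univ.pi fun _ => Set.Icc (-1) 1 :
      Set (Fin (d + 1) → Fin n → Fin n → ℝ)) :=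
    isCompact_univ_pi fun _ => isCompact_univ_pi fun _ => isCompact_univ_pi fun _ => isCompact_Icc
  refine IsCompact.of_isClosed_subset hK hcl ?_
  rintro P ⟨hs, hi, -, -⟩ j - a - b -
  -- the diagonal entry `P a a` is the sum of the squares of row `a`
  have h1 : P j a a = ∑ c, P j a c ^ 2 := by
    conv_lhs => rw [← hi j, Matrix.mul_apply]
    refine Finset.sum_congr rfl fun c _ => ?_
    rw [← Matrix.transpose_apply (P j) a c, hs j, sq]
  have h2 (c : Fin n) : P j a c ^ 2 ≤ P j a a := by
    rw [h1]
    exact Finset.single_le_sum (f := fun c => P j a c ^ 2) (fun _ _ => sq_nonneg _)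
      (Finset.mem_univ c)
  exact abs_le.1 (abs_le_of_sq_le_sq (by nlinarith [h2 a, h2 b]) zero_le_one)

instance : CompactSpace (FlagMfd d n m) := by
  refine ⟨isInducing_emb.isCompact_iff.2 ?_⟩
  rw [Set.image_univ, funext FlagMfd.emb_eq]
  have hf : Continuous fun (P : Fin (d + 1) → Matrix (Fin n) (Fin n) ℝ) j =>
    (2 : ℝ) • P j - 1 := by fun_prop
  have := (isCompact_projTuples (d := d) (n := n) (m := m)).image hf
  rwa [← range_proj, ← Set.range_comp] at this

instance : SecondCountableTopology (FlagMfd d n m) :=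
  have : SecondCountableTopology (Fin (d + 1) → Matrix (Fin n) (Fin n) ℝ) :=
    inferInstanceAs (SecondCountableTopology (Fin (d + 1) → Fin n → Fin n → ℝ))
  isInducing_emb.secondCountableTopology

/-! ### The objective function -/

/-- The part of the objective function that depends on the flag is linear in its projections. -/
lemma objective_eq (U : Fin (d + 1) → Submodule ℝ (EuclideanSpace ℝ (Fin n)))
    (W : FlagMfd d n m) :
    objective U W = 4 * ∑ j, (Module.finrank ℝ (U j) + m j : ℝ) -
      8 * ∑ j, (projMatrix (U j) * W.proj j).trace := by
  have h (A : Matrix (Fin n) (Fin n) ℝ) : frobSq A = (A * A.transpose).trace := by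
    simp [frobSq, Matrix.trace, Matrix.mul_apply, sq]
  rw [objective, Finset.mul_sum, Finset.mul_sum, ← Finset.sum_sub_distrib]
  refine Finset.sum_congr rfl fun j _ => ?_
  have h1 : tau (U j) - tau (W.space j) = (2 : ℝ) • (projMatrix (U j) - W.proj j) := by
    rw [tau_eq_projMatrix, tau_eq_projMatrix, smul_sub, FlagMfd.proj]
    abel
  rw [h1, h, Matrix.transpose_smul, Matrix.transpose_sub, projMatrix_transpose, W.proj_mem.1,
    smul_mul_smul_comm, Matrix.trace_smul, sub_mul, mul_sub, mul_sub, projMatrix_mul_self,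
    W.proj_mem.2.1, Matrix.trace_sub, Matrix.trace_sub, Matrix.trace_sub,
    Matrix.trace_mul_comm (W.proj j), trace_projMatrix, W.proj_mem.2.2.1, smul_eq_mul]
  ring

lemma continuous_objective (U : Fin (d + 1) → Submodule ℝ (EuclideanSpace ℝ (Fin n))) :
    Continuous (objective U : FlagMfd d n m → ℝ) := by
  rw [funext (objective_eq U)]
  have h := continuous_proj (d := d) (n := n) (m := m)
  fun_prop

lemma objective_nonneg (U : Fin (d + 1) → Submodule ℝ (EuclideanSpace ℝ (Fin n)))
    (W : FlagMfd d n m) : 0 ≤ objective U W :=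
  Finset.sum_nonneg fun _ _ => Finset.sum_nonneg fun _ _ => Finset.sum_nonneg fun _ _ =>
    sq_nonneg _

/-! ### The gradient of the objective function -/

/-- The sum of the commutators `[Pⱼ, Qⱼ]`. For symmetric `Q` it encodes the gradient at the flag
with projections `P` of the function `P ↦ ∑ⱼ tr (Qⱼ Pⱼ)`. -/
def commSum (Q P : Fin (d + 1) → Matrix (Fin n) (Fin n) ℝ) : Matrix (Fin n) (Fin n) ℝ :=
  ∑ j, (P j * Q j - Q j * P j)

/-- The block `Pₛ (Qₛ - Qₜ) Pₜ` of `commSum Q P`, see `mul_commSum_mul`. -/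
def gradBlock (Q : Fin (d + 1) → Matrix (Fin n) (Fin n) ℝ) (s t : Fin (d + 1))
    (P : Fin (d + 1) → Matrix (Fin n) (Fin n) ℝ) : Matrix (Fin n) (Fin n) ℝ :=
  P s * (Q s - Q t) * P t

lemma gradBlock_transpose {Q P : Fin (d + 1) → Matrix (Fin n) (Fin n) ℝ}
    (hQ : ∀ j, (Q j).transpose = Q j) (hP : P ∈ projTuples d n m) (s t : Fin (d + 1)) :
    (gradBlock Q s t P).transpose = - gradBlock Q t s P := by
  simp only [gradBlock, Matrix.transpose_mul, Matrix.transpose_sub, hQ, hP.1, ← neg_sub (Q s) (Q t),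
    mul_neg, neg_mul, neg_neg, mul_assoc]

lemma mul_commSum_mul {Q P : Fin (d + 1) → Matrix (Fin n) (Fin n) ℝ}
    (hP : P ∈ projTuples d n m) (s t : Fin (d + 1)) :
    P s * commSum Q P * P t = gradBlock Q s t P := by
  obtain ⟨-, hi, -, ho⟩ := hP
  have h1 : P s * ∑ j, P j * Q j = P s * Q s := by
    rw [Finset.mul_sum, Finset.sum_eq_single s (fun l _ h => by rw [← mul_assoc, ho s l h.symm,
      zero_mul]) (by simp), ← mul_assoc, hi]
  have h2 : (∑ j, Q j * P j) * P t = Q t * P t := by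
    rw [Finset.sum_mul, Finset.sum_eq_single t (fun l _ h => by rw [mul_assoc, ho l t h,
      mul_zero]) (by simp), mul_assoc, hi]
  rw [commSum, Finset.sum_sub_distrib, mul_sub, sub_mul, h1, mul_assoc (P s) (∑ j, _), h2,
    gradBlock, mul_sub, sub_mul, mul_assoc (P s) (Q t)]

lemma commSum_eq_zero {Q P : Fin (d + 1) → Matrix (Fin n) (Fin n) ℝ}
    (hQ : ∀ j, (Q j).transpose = Q j) (hP : P ∈ projTuples d n m) (h1 : ∑ j, P j = 1)
    (h : ∀ q : IndexPair d, gradBlock Q q.1.1 q.1.2 P = 0) : commSum Q P = 0 := by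
  have hb (s t) : P s * commSum Q P * P t = 0 := by
    rcases lt_trichotomy s t with hst | rfl | hst
    · rw [mul_commSum_mul hP, h ⟨(s, t), hst⟩]
    · rw [mul_commSum_mul hP, gradBlock, sub_self, mul_zero, zero_mul]
    · rw [mul_commSum_mul hP, ← neg_eq_zero, ← gradBlock_transpose hQ hP,
        h ⟨(t, s), hst⟩, Matrix.transpose_zero]
  calc commSum Q P = (∑ s, P s) * commSum Q P * ∑ t, P t := by rw [h1, one_mul, mul_one]
    _ = 0 := by simp [Finset.sum_mul, Finset.mul_sum, hb]

lemma trace_mul_commutator (Q B P : Matrix (Fin n) (Fin n) ℝ) :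
    (Q * (B * P - P * B)).trace = (B * (P * Q - Q * P)).trace := by
  rw [mul_sub, mul_sub, Matrix.trace_sub, Matrix.trace_sub, Matrix.trace_mul_comm Q, mul_assoc,
    ← mul_assoc Q, Matrix.trace_mul_comm (Q * P)]

/-- If `P'` is tangent at `P` to the tuples of projections with sum `1`, then
`P'ⱼ = [B, Pⱼ]` for `B = ∑ₗ P'ₗ Pₗ`, so that `∑ⱼ tr (Qⱼ P'ⱼ)` is the trace of `B` times
`commSum Q P`. -/
lemma sum_trace_mul_tangent_eq_zero {Q P P' : Fin (d + 1) → Matrix (Fin n) (Fin n) ℝ}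
    (hP : P ∈ projTuples d n m) (h1 : ∑ j, P j = 1)
    (hi' : ∀ j, P' j * P j + P j * P' j = P' j)
    (ho' : ∀ j l, j ≠ l → P' j * P l + P j * P' l = 0) (h : commSum Q P = 0) :
    ∑ j, (Q j * P' j).trace = 0 := by
  obtain ⟨-, hi, -, ho⟩ := hP
  set B := ∑ l, P' l * P l with hB
  have hBP (j) : B * P j = P' j * P j := by
    rw [hB, Finset.sum_mul, Finset.sum_eq_single j (fun l _ h => by rw [mul_assoc, ho l j h,
      mul_zero]) (by simp), mul_assoc, hi]
  have hPB (j) : P j * B = - (P j * P' j) := by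
    have hterm (l) : P j * (P' l * P l) = if l = j then 0 else - (P' j * P l) := by
      split_ifs with hl
      · subst hl
        have h2 := congrArg (P l * ·) (hi' l)
        simp only [mul_add, ← mul_assoc, hi] at h2
        rw [← mul_assoc]
        exact add_eq_right.1 h2
      · rw [← mul_assoc, eq_neg_of_add_eq_zero_right (ho' j l (Ne.symm hl)), neg_mul, mul_assoc, hi]
    have h3 : P' j = ∑ l, P' j * P l := by rw [← Finset.mul_sum, h1, mul_one]
    have h4 : ∑ l, (if l = j then 0 else - (P' j * P l)) = P' j * P j - P' j := by
      conv_rhs => rw [h3, Finset.sum_mul, Finset.sum_eq_single j (fun l _ h => by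
        rw [mul_assoc, ho l j h, mul_zero]) (by simp), mul_assoc, hi,
        ← Finset.add_sum_erase _ _ (Finset.mem_univ j)]
      rw [← Finset.add_sum_erase _ _ (Finset.mem_univ j), if_pos rfl, zero_add, sub_add_cancel_left,
        ← Finset.sum_neg_distrib]
      exact Finset.sum_congr rfl fun l hl => if_neg (Finset.ne_of_mem_erase hl)
    rw [hB, Finset.mul_sum, Finset.sum_congr rfl fun l _ => hterm l, h4, sub_eq_iff_eq_add,
      neg_add_eq_sub, eq_sub_iff_add_eq, hi']
  have hP' (j) : P' j = B * P j - P j * B := by rw [hBP, hPB, sub_neg_eq_add, hi']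
  rw [Finset.sum_congr rfl fun j _ => by rw [hP' j, trace_mul_commutator],
    ← Matrix.trace_sum, ← Finset.mul_sum]
  change (B * commSum Q P).trace = 0
  rw [h, mul_zero, Matrix.trace_zero]

-- Derivatives and exponentials of matrices do not depend on the norm; any Banach algebra norm will do.
open scoped Matrix.Norms.Operator

lemma hasDerivAt_matrix {A : ℝ → Matrix (Fin n) (Fin n) ℝ} {A' : Matrix (Fin n) (Fin n) ℝ} {x : ℝ}
    (h : ∀ a b, HasDerivAt (fun t => A t a b) (A' a b) x) : HasDerivAt A A' x :=
  hasDerivAt_pi.2 fun a => hasDerivAt_pi.2 fun b => h a b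

lemma _root_.HasDerivAt.trace_const_mul {A : ℝ → Matrix (Fin n) (Fin n) ℝ}
    {A' : Matrix (Fin n) (Fin n) ℝ} {x : ℝ} (h : HasDerivAt A A' x)
    (Q : Matrix (Fin n) (Fin n) ℝ) :
    HasDerivAt (fun t => (Q * A t).trace) (Q * A').trace x := by
  let T : Matrix (Fin n) (Fin n) ℝ →L[ℝ] ℝ :=
    LinearMap.toContinuousLinearMap (Matrix.traceLinearMap (Fin n) ℝ ℝ)
  exact T.hasFDerivAt.comp_hasDerivAt x (h.const_mul Q)

/-- A flag at which all blocks of the gradient vanish is a stationary point. -/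
lemma isStationary_of_gradBlock_eq_zero
    (U : Fin (d + 1) → Submodule ℝ (EuclideanSpace ℝ (Fin n))) (hm : ∑ j, m j = n)
    (W : FlagMfd d n m)
    (h : ∀ q : IndexPair d, gradBlock (fun j => projMatrix (U j)) q.1.1 q.1.2 W.proj = 0) :
    IsStationary (objective U) W := by
  rintro c rfl hc
  set P' : Fin (d + 1) → Matrix (Fin n) (Fin n) ℝ :=
    fun j => Matrix.of fun a b => deriv (fun t => (c t).proj j a b) 0
  have hd (j) : HasDerivAt (fun t => (c t).proj j) (P' j) 0 := by
    refine hasDerivAt_matrix fun a b => DifferentiableAt.hasDerivAt ?_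
    have h2 : (fun t => (c t).proj j a b) =
        fun t => (1 / 2 : ℝ) * ((c t).emb j a b + (1 : Matrix (Fin n) (Fin n) ℝ) a b) := by
      ext t
      rw [FlagMfd.proj_eq]
      rfl
    rw [h2]
    exact ((hc j a b).add_const _).const_mul _
  have hi' (j) : P' j * (c 0).proj j + (c 0).proj j * P' j = P' j := by
    have h2 := (hd j).mul (hd j)
    rw [show (fun t => (c t).proj j) * (fun t => (c t).proj j) = fun t => (c t).proj j from
      funext fun t => (c t).proj_mem.2.1 j] at h2
    exact h2.unique (hd j)
  have ho' (j l) (hjl : j ≠ l) : P' j * (c 0).proj l + (c 0).proj j * P' l = 0 := by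
    have h2 := (hd j).mul (hd l)
    rw [show (fun t => (c t).proj j) * (fun t => (c t).proj l) = fun _ => 0 from
      funext fun t => (c t).proj_mem.2.2.2 j l hjl] at h2
    exact h2.unique (hasDerivAt_const _ _)
  have h0 := sum_trace_mul_tangent_eq_zero (c 0).proj_mem ((c 0).sum_proj hm) hi' ho'
    (commSum_eq_zero (fun j => projMatrix_transpose _) (c 0).proj_mem ((c 0).sum_proj hm) h)
  have h3 : HasDerivAt (fun t => ∑ j, (projMatrix (U j) * (c t).proj j).trace)
      (∑ j, (projMatrix (U j) * P' j).trace) 0 :=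
    HasDerivAt.fun_sum fun j _ => (hd j).trace_const_mul _
  have h4 := (h3.const_mul 8).const_sub (4 * ∑ j, (Module.finrank ℝ (U j) + m j : ℝ))
  rw [h0, mul_zero, neg_zero] at h4
  rw [funext fun t => objective_eq U (c t)]
  exact h4

/-! ### Descent within one pair of indices -/

/-- The conjugate of the matrix `A` by `exp (x G)`, which is a rotation if `G` is skew. -/
def expConj (G : Matrix (Fin n) (Fin n) ℝ) (x : ℝ) (A : Matrix (Fin n) (Fin n) ℝ) :
    Matrix (Fin n) (Fin n) ℝ :=
  NormedSpace.exp (x • G) * A * NormedSpace.exp (x • -G)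

lemma exp_smul_neg_mul_exp_smul (G : Matrix (Fin n) (Fin n) ℝ) (x : ℝ) :
    NormedSpace.exp (x • -G) * NormedSpace.exp (x • G) = 1 := by
  rw [← Matrix.exp_add_of_commute, smul_neg, neg_add_cancel, NormedSpace.exp_zero]
  exact ((Commute.refl G).neg_left.smul_left x).smul_right x

lemma expConj_mul (G : Matrix (Fin n) (Fin n) ℝ) (x : ℝ) (A B : Matrix (Fin n) (Fin n) ℝ) :
    expConj G x A * expConj G x B = expConj G x (A * B) := by
  simp only [expConj, mul_assoc]
  rw [← mul_assoc (NormedSpace.exp (x • -G)) (NormedSpace.exp (x • G)),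
    exp_smul_neg_mul_exp_smul, one_mul]

lemma expConj_mem_projTuples {G : Matrix (Fin n) (Fin n) ℝ} (hG : G.transpose = -G) (x : ℝ)
    {P : Fin (d + 1) → Matrix (Fin n) (Fin n) ℝ} (hP : P ∈ projTuples d n m) :
    (fun j => expConj G x (P j)) ∈ projTuples d n m := by
  obtain ⟨hs, hi, ht, ho⟩ := hP
  refine ⟨fun j => ?_, fun j => ?_, fun j => ?_, fun j l h => ?_⟩
  · simp only [expConj, Matrix.transpose_mul, ← Matrix.exp_transpose, Matrix.transpose_smul,
      Matrix.transpose_neg, hG, hs, neg_neg, mul_assoc]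
  · rw [expConj_mul, hi]
  · change (expConj G x (P j)).trace = m j
    rw [expConj, Matrix.trace_mul_comm, ← mul_assoc, exp_smul_neg_mul_exp_smul, one_mul, ht]
  · rw [expConj_mul, ho j l h, expConj, mul_zero, zero_mul]

lemma expConj_eq_self {G A : Matrix (Fin n) (Fin n) ℝ} (h1 : G * A = 0) (h2 : A * G = 0) (x : ℝ) :
    expConj G x A = A := by
  have h : Commute A (x • -G) := by
    simp [Commute, SemiconjBy, h1, h2]
  rw [expConj, mul_assoc, h.exp_right.eq, ← mul_assoc]
  have h3 := exp_smul_neg_mul_exp_smul (-G) x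
  rw [neg_neg] at h3
  rw [h3, one_mul]

lemma continuous_expConj {X : Type*} [TopologicalSpace X] {G A : X → Matrix (Fin n) (Fin n) ℝ}
    (hG : Continuous G) (hA : Continuous A) (x : ℝ) :
    Continuous fun y => expConj (G y) x (A y) := by
  have h : Continuous (NormedSpace.exp : Matrix (Fin n) (Fin n) ℝ → _) :=
    NormedSpace.exp_continuous
  exact ((h.comp (hG.const_smul x)).mul hA).mul (h.comp (hG.neg.const_smul x))

lemma hasDerivAt_expConj (G A : Matrix (Fin n) (Fin n) ℝ) :
    HasDerivAt (fun x => expConj G x A) (G * A - A * G) 0 := by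
  have h := ((hasDerivAt_exp_smul_const G (0 : ℝ)).mul_const A).mul
    (hasDerivAt_exp_smul_const (-G) (0 : ℝ))
  convert! h using 1
  simp [sub_eq_add_neg]
/-- The generator of the rotation in the indices `s` and `t` along which `∑ⱼ tr (Qⱼ Pⱼ)` grows
fastest. It depends continuously on `P`. -/
def ascentGen (Q : Fin (d + 1) → Matrix (Fin n) (Fin n) ℝ) (s t : Fin (d + 1))
    (P : Fin (d + 1) → Matrix (Fin n) (Fin n) ℝ) : Matrix (Fin n) (Fin n) ℝ :=
  (gradBlock Q s t P).transpose - gradBlock Q s t P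

lemma ascentGen_transpose (Q : Fin (d + 1) → Matrix (Fin n) (Fin n) ℝ) (s t : Fin (d + 1))
    (P : Fin (d + 1) → Matrix (Fin n) (Fin n) ℝ) :
    (ascentGen Q s t P).transpose = - ascentGen Q s t P := by
  simp [ascentGen]

lemma continuous_ascentGen (Q : Fin (d + 1) → Matrix (Fin n) (Fin n) ℝ) (s t : Fin (d + 1)) :
    Continuous (ascentGen Q s t) := by
  unfold ascentGen gradBlock
  fun_prop

lemma expConj_ascentGen_eq_self {Q P : Fin (d + 1) → Matrix (Fin n) (Fin n) ℝ}
    (hQ : ∀ j, (Q j).transpose = Q j) (hP : P ∈ projTuples d n m) {s t j : Fin (d + 1)}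
    (hs : j ≠ s) (ht : j ≠ t) (x : ℝ) : expConj (ascentGen Q s t P) x (P j) = P j := by
  refine expConj_eq_self ?_ ?_ x <;> rw [ascentGen, gradBlock_transpose hQ hP]
  · simp [sub_mul, gradBlock, mul_assoc, hP.2.2.2 _ _ hs.symm, hP.2.2.2 _ _ ht.symm]
  · simp [mul_sub, gradBlock, ← mul_assoc, hP.2.2.2 _ _ hs, hP.2.2.2 _ _ ht]

lemma trace_gradBlock_mul_commSum {Q P : Fin (d + 1) → Matrix (Fin n) (Fin n) ℝ}
    (hQ : ∀ j, (Q j).transpose = Q j) (hP : P ∈ projTuples d n m) (s t : Fin (d + 1)) :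
    (gradBlock Q s t P * commSum Q P).trace =
      - ((gradBlock Q s t P).transpose * gradBlock Q s t P).trace := by
  have h1 : gradBlock Q s t P = P s * gradBlock Q s t P * P t := by
    simp only [gradBlock, ← mul_assoc, hP.2.1]
    rw [mul_assoc _ (P t) (P t), hP.2.1]
  conv_lhs => rw [h1, mul_assoc, mul_assoc, Matrix.trace_mul_comm, mul_assoc,
    mul_commSum_mul hP, ← neg_neg (gradBlock Q t s P), ← gradBlock_transpose hQ hP]
  rw [mul_neg, Matrix.trace_neg, Matrix.trace_mul_comm]

/-- The initial rate of growth of `∑ⱼ tr (Qⱼ Pⱼ)` under the rotations generated by `ascentGen` is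
twice the squared Frobenius norm of the block of the gradient. -/
lemma sum_trace_mul_ascentGen {Q P : Fin (d + 1) → Matrix (Fin n) (Fin n) ℝ}
    (hQ : ∀ j, (Q j).transpose = Q j) (hP : P ∈ projTuples d n m) (s t : Fin (d + 1)) :
    ∑ j, (Q j * (ascentGen Q s t P * P j - P j * ascentGen Q s t P)).trace =
      2 * ((gradBlock Q s t P).transpose * gradBlock Q s t P).trace := by
  rw [Finset.sum_congr rfl fun j _ => trace_mul_commutator _ _ _, ← Matrix.trace_sum,
    ← Finset.mul_sum]
  change (ascentGen Q s t P * commSum Q P).trace = _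
  rw [ascentGen, sub_mul, Matrix.trace_sub, trace_gradBlock_mul_commSum hQ hP,
    gradBlock_transpose hQ hP, neg_mul, Matrix.trace_neg, trace_gradBlock_mul_commSum hQ hP,
    gradBlock_transpose hQ hP t s, neg_mul, neg_mul, Matrix.trace_neg, Matrix.trace_neg,
    Matrix.trace_mul_comm (gradBlock Q s t P)]
  ring

/-- Where a block of the gradient does not vanish, the sub-problem for its pair of indices allows
a decrease of the objective function that is locally bounded away from zero. -/
lemma exists_open_uniform_decrease (U : Fin (d + 1) → Submodule ℝ (EuclideanSpace ℝ (Fin n)))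
    (V : FlagMfd d n m) (q : IndexPair d)
    (h : gradBlock (fun j => projMatrix (U j)) q.1.1 q.1.2 V.proj ≠ 0) :
    ∃ N : Set (FlagMfd d n m), IsOpen N ∧ V ∈ N ∧ ∃ δ > 0, ∀ W ∈ N, ∃ Y, Feasible q W Y ∧
      objective U Y < objective U W - δ := by
  set Q := fun j => projMatrix (U j) with hQdef
  have hQ : ∀ j, (Q j).transpose = Q j := fun j => projMatrix_transpose _
  let φ (x : ℝ) (W : FlagMfd d n m) : ℝ :=
    ∑ j, (Q j * expConj (ascentGen Q q.1.1 q.1.2 W.proj) x (W.proj j)).trace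
  have hφ0 (W) : φ 0 W = ∑ j, (Q j * W.proj j).trace := by
    simp [φ, expConj]
  have hφc (x) : Continuous (φ x) := by
    have h1 := continuous_proj (d := d) (n := n) (m := m)
    have h2 (j) := continuous_expConj ((continuous_ascentGen Q q.1.1 q.1.2).comp h1)
      ((continuous_apply j).comp h1) x
    exact continuous_finsetSum _ fun j _ => (continuous_const.mul (h2 j)).matrix_trace
  -- otherwise `x ↦ φ x V` would have a maximum at `0`, where its derivative is positive
  obtain ⟨x, hx⟩ : ∃ x, φ 0 V < φ x V := by
    by_contra! hmax
    have hder : HasDerivAt (fun x => φ x V)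
        (∑ j, (Q j * (ascentGen Q q.1.1 q.1.2 V.proj * V.proj j -
          V.proj j * ascentGen Q q.1.1 q.1.2 V.proj)).trace) 0 :=
      HasDerivAt.fun_sum fun j _ => (hasDerivAt_expConj _ _).trace_const_mul _
    have h0 := IsLocalMax.hasDerivAt_eq_zero (Eventually.of_forall hmax) hder
    rw [sum_trace_mul_ascentGen hQ V.proj_mem, mul_eq_zero, or_iff_right two_ne_zero,
      ← Matrix.conjTranspose_eq_transpose_of_trivial,
      Matrix.trace_conjTranspose_mul_self_eq_zero_iff] at h0
    exact h h0
  -- half of the decrease at `V` is left on the neighbourhood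
  refine ⟨{W | 4 * (φ x V - φ 0 V) < 8 * (φ x W - φ 0 W)}, ?_, ?_, 4 * (φ x V - φ 0 V),
    by linarith, fun W hW => ?_⟩
  · exact isOpen_lt continuous_const (continuous_const.mul ((hφc x).sub (hφc 0)))
  · change 4 * (φ x V - φ 0 V) < 8 * (φ x V - φ 0 V)
    linarith
  · obtain ⟨Y, hY⟩ := exists_flag_proj_eq (expConj_mem_projTuples
      (ascentGen_transpose Q q.1.1 q.1.2 W.proj) x W.proj_mem)
    refine ⟨Y, fun j hs ht => projMatrix_injective ?_, ?_⟩
    · change Y.proj j = W.proj j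
      rw [hY]
      exact expConj_ascentGen_eq_self hQ W.proj_mem hs ht x
    · have h1 : ∑ j, (Q j * Y.proj j).trace = φ x W := by rw [hY]
      rw [objective_eq, objective_eq, h1, ← hφ0]
      have h2 : 4 * (φ x V - φ 0 V) < 8 * (φ x W - φ 0 W) := hW
      linarith

/-! ### Visits to a region of uniform decrease -/

/-- Almost surely, the iterates visit only finitely often an open set on which the sub-problem for
one pair of indices allows a decrease by at least `δ > 0`: each visit is followed with
a fixed positive probability by the choice of this pair, and there can be only
boundedly many such decreases. -/
lemma IsRandomizedCoordMin.ae_eventually_notMem {Ω : Type*} [mΩ : MeasurableSpace Ω]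
    {μ : Measure Ω} [IsProbabilityMeasure μ] {ℱ : Filtration ℕ mΩ} {f : FlagMfd d n m → ℝ}
    {p : ℕ → Ω → IndexPair d} {W : ℕ → Ω → FlagMfd d n m}
    (hW : IsRandomizedCoordMin μ ℱ f p W) (hf : Continuous f) (hf0 : ∀ X, 0 ≤ f X)
    {N : Set (FlagMfd d n m)} (hN : IsOpen N) (q : IndexPair d) {δ : ℝ} (hδ : 0 < δ)
    (hdec : ∀ X ∈ N, ∃ Y, Feasible q X Y ∧ f Y < f X - δ) :
    ∀ᵐ ω ∂μ, ∀ᶠ i in atTop, W i ω ∉ N := by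
  obtain ⟨C, hC⟩ := (isCompact_range hf).bddAbove
  let E (i : ℕ) : Set Ω := {ω | p i ω = q} ∩ W i ⁻¹' N
  have hBm (i) : MeasurableSet[ℱ i] (W i ⁻¹' N) := hW.measurable_iterate i hN.measurableSet
  have hpm (i) : MeasurableSet {ω | p i ω = q} :=
    ℱ.le (i + 1) _ (hW.measurable_pair i (measurableSet_singleton q))
  have hEm (i) : MeasurableSet (E i) := (hpm i).inter (ℱ.le i _ (hBm i))
  have hμE (i) : μ (E i) = (Fintype.card (IndexPair d) : ENNReal)⁻¹ * μ (W i ⁻¹' N) := by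
    rw [← hW.uniform i q]
    exact (Indep_iff _ _ _).1 (hW.indep i) _ _ ⟨{q}, measurableSet_singleton q, rfl⟩ (hBm i)
  have hstep : ∀ᵐ ω ∂μ, ∀ i, f (W (i + 1) ω) + (E i).indicator (fun _ => δ) ω ≤ f (W i ω) := by
    filter_upwards [ae_all_iff.2 hW.step] with ω hω i
    by_cases hE : ω ∈ E i
    · obtain ⟨Y, hY, hlt⟩ := hdec _ hE.2
      have hq : p i ω = q := hE.1
      have := (hω i).2 Y (hq ▸ hY)
      rw [Set.indicator_of_mem hE]
      linarith
    · rw [Set.indicator_of_notMem hE, add_zero]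
      exact (hω i).2 _ fun _ _ _ => rfl
  have hsum (k : ℕ) : ∀ᵐ ω ∂μ, ∑ i ∈ Finset.range k, (E i).indicator (fun _ => δ) ω ≤ C := by
    filter_upwards [hstep] with ω hω
    have h1 : f (W k ω) + ∑ i ∈ Finset.range k, (E i).indicator (fun _ => δ) ω ≤ f (W 0 ω) := by
      induction k with
      | zero => simp
      | succ k ih =>
        rw [Finset.sum_range_succ]
        linarith [hω k]
    linarith [hf0 (W k ω), hC ⟨W 0 ω, rfl⟩]
  have hbound (k : ℕ) : ∑ i ∈ Finset.range k, μ (E i) ≤ ENNReal.ofReal (C / δ) := by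
    have h1 : ∑ i ∈ Finset.range k, μ.real (E i) * δ ≤ C := by
      calc ∑ i ∈ Finset.range k, μ.real (E i) * δ
          = ∫ ω, ∑ i ∈ Finset.range k, (E i).indicator (fun _ => δ) ω ∂μ := by
            rw [integral_finsetSum _ fun i _ => (integrable_const δ).indicator (hEm i)]
            exact Finset.sum_congr rfl fun i _ => by rw [integral_indicator_const _ (hEm i)]; rfl
        _ ≤ ∫ _, C ∂μ := integral_mono_ae
            (integrable_finsetSum _ fun i _ => (integrable_const δ).indicator (hEm i))
            (integrable_const C) (hsum k)
        _ = C := by simp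
    rw [← Finset.sum_mul, ← le_div_iff₀ hδ] at h1
    calc ∑ i ∈ Finset.range k, μ (E i)
        = ENNReal.ofReal (∑ i ∈ Finset.range k, μ.real (E i)) := by
          rw [ENNReal.ofReal_sum_of_nonneg fun i _ => measureReal_nonneg]
          exact Finset.sum_congr rfl fun i _ => by simp
      _ ≤ _ := ENNReal.ofReal_le_ofReal h1
  have htsum := ENNReal.tsum_le_of_sum_range_le hbound
  rw [tsum_congr hμE, ENNReal.tsum_mul_left] at htsum
  refine MeasureTheory.ae_eventually_notMem (s := fun i => W i ⁻¹' N) fun htop => ?_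
  rw [htop, ENNReal.mul_top (by simp)] at htsum
  exact ENNReal.ofReal_ne_top (top_le_iff.1 htsum)

end NearestFlag
end

theorem mainTheorem3 {d n : ℕ}
    (U : Fin (d + 1) → Submodule ℝ (EuclideanSpace ℝ (Fin n)))
    (hn : ∑ j, Module.finrank ℝ (U j) = n)
    {Ω : Type*} [mΩ : MeasurableSpace Ω] (μ : MeasureTheory.Measure Ω)
    [MeasureTheory.IsProbabilityMeasure μ] (ℱ : MeasureTheory.Filtration ℕ mΩ)
    (p : ℕ → Ω → NearestFlag.IndexPair d)
    (W : ℕ → Ω → NearestFlag.FlagMfd d n (fun j => Module.finrank ℝ (U j)))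
    (hW : NearestFlag.IsRandomizedCoordMin μ ℱ (NearestFlag.objective U) p W) :
    (∀ ω, ∃ x, MapClusterPt x Filter.atTop (fun i => W i ω)) ∧
    ∀ᵐ ω ∂μ, ∀ x, MapClusterPt x Filter.atTop (fun i => W i ω) →
      NearestFlag.IsStationary (NearestFlag.objective U) x := by
  refine ⟨fun ω => exists_clusterPt_of_compactSpace _, ?_⟩
  have hae : ∀ᵐ ω ∂μ, ∀ N ∈ TopologicalSpace.countableBasis
      (NearestFlag.FlagMfd d n (fun j => Module.finrank ℝ (U j))),
      (∃ q, ∃ δ > 0, ∀ X ∈ N, ∃ Y, NearestFlag.Feasible q X Y ∧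
        NearestFlag.objective U Y < NearestFlag.objective U X - δ) →
      ∀ᶠ i in atTop, W i ω ∉ N := by
    rw [ae_ball_iff (TopologicalSpace.countable_countableBasis _)]
    intro N hN
    by_cases h : ∃ q, ∃ δ > 0, ∀ X ∈ N, ∃ Y, NearestFlag.Feasible q X Y ∧
        NearestFlag.objective U Y < NearestFlag.objective U X - δ
    · obtain ⟨q, δ, hδ, hdec⟩ := h
      filter_upwards [hW.ae_eventually_notMem (NearestFlag.continuous_objective U)
        (NearestFlag.objective_nonneg U) (TopologicalSpace.isOpen_of_mem_countableBasis hN)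
        q hδ hdec] with ω hω _ using hω
    · exact Eventually.of_forall fun ω h' => absurd h' h
  -- a block that is not zero at a cluster point would put it into one of these basic open sets
  filter_upwards [hae] with ω hω x hx
  refine NearestFlag.isStationary_of_gradBlock_eq_zero U hn x fun q => ?_
  by_contra hq
  obtain ⟨N, hNo, hxN, δ, hδ, hdec⟩ := NearestFlag.exists_open_uniform_decrease U x q hq
  obtain ⟨B, hB, hxB, hBN⟩ :=
    (TopologicalSpace.isBasis_countableBasis _).exists_subset_of_mem_open hxN hNo
  have hev := hω B hB ⟨q, δ, hδ, fun X hX => hdec X (hBN hX)⟩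
  have hfr := hx.frequently ((TopologicalSpace.isOpen_of_mem_countableBasis hB).mem_nhds hxB)
  exact hfr hev
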